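/- Let $G=(V,E)$ be a finite digraph without loops or multiple arcs whose underlying undirected graph is connected, let $b\in\mathbb{R}^V$ be a source vector, and let $\ell\in\mathbb{R}^E$ with $\ell_{ij}>0$ for every arc $ij$. Let $B\in\mathbb{R}^{V\times E}$ be the boundary operator of $G$: $B_{ie}=-1$ if $i$ is the head of $e$, $B_{ie}=+1$ if $i$ is the tail of $e$, and $B_{ie}=0$ otherwise. Let $\Phi^+=\{\phi\in\mathbb{R}^E : B\phi=b,\ \phi\ge 0\}$ be the set of positive flows, let $\hat\Phi$ be the set of those $\phi\in\Phi^+$ that minimise the cost $\ell^T\phi=\sum_{ij\in E}\ell_{ij}\phi_{ij}$ over $\Phi^+$, and let $\hat H=\bigcup_{f\in\hat\Phi}\operatorname{supp} f\subseteq E$ be (the arc set of) the optimal subgraph. The non-symmetric Physarum solver is a conductivity vector $\sigma(t)\in\mathbb{R}^E$, $t\in[0,\infty)$, with $\sigma_{ij}(t)>0$ for all $ij\in E$ (the initial state $\sigma(0)>0$ is arbitrary), that satisfies $$\frac{d}{dt}\sigma_{ij}(t)+\sigma_{ij}(t)=\phi_{ij}(t),\qquad ij\in E,\ t\ge 0,$$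 where the current $\phi(t)$ is given by Ohm's law $\phi_{ij}(t)=\sigma_{ij}(t)\,(p_i(t)-p_j(t))/\ell_{ij}$ from a potential $p(t)\in\mathbb{R}^V$ that solves Kirchhoff's equations $L(\sigma(t))\,p(t)=b$ with $L(\sigma)=B\operatorname{diag}(\sigma/\ell)B^T$. Theorem. Assume that the transshipment problem is feasible, i.e. $\Phi^+\neq\emptyset$. Then the current $\phi(t)$ of the Physarum solver converges exponentially fast to an optimal flow: there are $\hat\phi\in\hat\Phi$ and constants $C$ and $c>0$ such that $|\phi_{ij}(t)-\hat\phi_{ij}|\le C e^{-ct}$ for all $t\ge 0$ and all $ij\in E$. Moreover, the limit flow has full support: $\operatorname{supp}\hat\phi=\hat H$. -/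

import Mathlib

open scoped Matrix

namespace Physarum

/-- The arcs of a digraph, as ordered pairs (tail, head). -/
abbrev Arc {V : Type*} (G : Digraph V) : Type _ := {e : V × V // G.Adj e.1 e.2}

section

variable {V : Type*} [Fintype V] [DecidableEq V] (G : Digraph V) [DecidableRel G.Adj]

/-- The boundary operator (oriented incidence matrix) of a loopless digraph: `-1` at the head,
`+1` at the tail, `0` at all other nodes. -/
def boundary : Matrix V (Arc G) ℝ :=
  fun i e => if i = e.1.2 then -1 else if i = e.1.1 then 1 else 0

/-- The feasible set of the transshipment problem: all `φ` with `B φ = b` and `φ ≥ 0`. -/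
def positiveFlows (b : V → ℝ) : Set (Arc G → ℝ) :=
  {φ | boundary G *ᵥ φ = b ∧ ∀ e, 0 ≤ φ e}

/-- The linear cost `ℓᵀ φ`. -/
def cost (l : Arc G → ℝ) (φ : Arc G → ℝ) : ℝ := l ⬝ᵥ φ

/-- The optimal flows: positive flows of minimum cost. -/
def optimalFlows (b : V → ℝ) (l : Arc G → ℝ) : Set (Arc G → ℝ) :=
  {φ | φ ∈ positiveFlows G b ∧ ∀ f ∈ positiveFlows G b, cost G l φ ≤ cost G l f}

/-- The arc set of the optimal subgraph: the union of the supports of all optimal flows. -/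
def optimalArcs (b : V → ℝ) (l : Arc G → ℝ) : Set (Arc G) :=
  ⋃ f ∈ optimalFlows G b l, Function.support f

/-- The weighted graph Laplacian `L(σ) = B diag(σ / ℓ) Bᵀ`. -/
noncomputable def laplacian (l σ : Arc G → ℝ) : Matrix V V ℝ :=
  boundary G * Matrix.diagonal (fun e => σ e / l e) * (boundary G)ᵀ

/-- The field `Ψ(p) = (Bᵀ p) / ℓ` of a potential `p`. -/
noncomputable def field (l : Arc G → ℝ) (p : V → ℝ) : Arc G → ℝ :=
  fun e => ((boundary G)ᵀ *ᵥ p) e / l e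

/-- `φ` is the electric current driven by the sources `b` in the resistor network with lengths `l`
and conductivities `σ`: it is given by Ohm's law from a solution `p` of Kirchhoff's equations
`L(σ) p = b`. -/
def IsCurrent (b : V → ℝ) (l σ φ : Arc G → ℝ) : Prop :=
  ∃ p : V → ℝ, laplacian G l σ *ᵥ p = b ∧ ∀ e, φ e = σ e * field G l p e

/-- The (non-symmetric) Physarum solver on `[0, ∞)`: conductivities `σ t` in the positive orthant
that evolve by `dσ/dt + σ = φ`, where `φ t` is the electric current determined by `σ t`.
The derivative is one-sided at `t = 0`. -/
structure IsPhysarumSolver (b : V → ℝ) (l : Arc G → ℝ) (σ φ : ℝ → Arc G → ℝ) : Prop where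
  pos : ∀ t, 0 ≤ t → ∀ e, 0 < σ t e
  current : ∀ t, 0 ≤ t → IsCurrent G b l (σ t) (φ t)
  evolution : ∀ t, 0 ≤ t → ∀ e,
    HasDerivWithinAt (fun s => σ s e) (φ t e - σ t e) (Set.Ici 0) t

end

end Physarum

/-!
Let `W` be the kernel of the boundary operator and `f` an optimal flow of full support. Along a
Physarum solver `σ' / σ` is the field of a potential minus one, and such fields are orthogonal to
`W` in the inner product weighted by `l`. Hence `∑ l h log (σ t / σ 0) = -t lᵀ h` for every `h ∈ W`,
while `B σ - b` decays like `e⁻ᵗ`. Thus the solver is explicit: `σ t` is the stationary point of the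
linear programme, with right-hand side perturbed by `O(e⁻ᵗ)` and cost regularised by `1 / t` times
an entropy (`IsPhysarumSolver.entropicPath`). Everything else is read off from these two identities.

* Testing with `σ t - comparison`, where `comparison` joins `σ 0` to `f`, bounds `σ` from above
  (`EntropicPath.bounded_above`).
* Off `supp f` the conductivities decay exponentially (`EntropicPath.expSmall_of_eq_zero`). This
  uses a finite set of generators of `W` in which every circulation decomposes without cancellation
  (`exists_conformal_generators`); a generator that leaves `supp f` either decreases an arc where
  hardly anything can be removed, or has positive cost and is penalised by the factor `t`.
* On `supp f` the conductivities stay away from zero (`EntropicPath.bounded_below`), and strict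
  monotonicity of the logarithm gives an exponential Cauchy estimate, hence a limit `z`, which
  differs from `f` by a circulation of cost zero (`EntropicPath.exists_limit`). So `z` is optimal and has
  full support.
* The energy of the current is bounded by that of `f`, so the current is exponentially small off
  `supp f`; then the energy of the circulation `φ - z` is exponentially small as well, because it
  agrees with a cost difference up to exponentially small terms
  (`EntropicPath.expSmall_current_sub`).
-/

namespace Physarum

/-! ### Exponentially small functions -/

/-- A function on `[0, ∞)` that is bounded by a decaying exponential. Values at negative arguments
play no role. -/
def ExpSmall (f : ℝ → ℝ) : Prop :=
  ∃ C c : ℝ, 0 < c ∧ ∀ t, 0 ≤ t → |f t| ≤ C * Real.exp (-(c * t))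

namespace ExpSmall

variable {f g : ℝ → ℝ}

theorem of_le {K : ℝ} (hg : ExpSmall g) (h : ∀ t, 0 ≤ t → |f t| ≤ K * |g t|) : ExpSmall f := by
  obtain ⟨C, c, hc, hC⟩ := hg
  refine ⟨|K| * C, c, hc, fun t ht => ?_⟩
  calc |f t| ≤ K * |g t| := h t ht
    _ ≤ |K| * |g t| := by gcongr; exact le_abs_self K
    _ ≤ |K| * (C * Real.exp (-(c * t))) := by gcongr; exact hC t ht
    _ = _ := by ring

theorem of_abs_le (hg : ExpSmall g) (h : ∀ t, 0 ≤ t → |f t| ≤ g t) : ExpSmall f :=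
  hg.of_le (K := 1) fun t ht => by rw [one_mul]; exact (h t ht).trans (le_abs_self _)

theorem zero : ExpSmall fun _ => 0 := ⟨0, 1, one_pos, fun t _ => by simp⟩

theorem exp_neg : ExpSmall fun t => Real.exp (-t) :=
  ⟨1, 1, one_pos, fun t _ => by simp⟩

theorem add (hf : ExpSmall f) (hg : ExpSmall g) : ExpSmall fun t => f t + g t := by
  obtain ⟨C, c, hc, hC⟩ := hf
  obtain ⟨D, d, hd, hD⟩ := hg
  refine ⟨|C| + |D|, min c d, lt_min hc hd, fun t ht => ?_⟩
  have h1 : Real.exp (-(c * t)) ≤ Real.exp (-(min c d * t)) := by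
    gcongr; exact min_le_left _ _
  have h2 : Real.exp (-(d * t)) ≤ Real.exp (-(min c d * t)) := by
    gcongr; exact min_le_right _ _
  calc |f t + g t| ≤ |f t| + |g t| := abs_add_le _ _
    _ ≤ C * Real.exp (-(c * t)) + D * Real.exp (-(d * t)) := add_le_add (hC t ht) (hD t ht)
    _ ≤ |C| * Real.exp (-(min c d * t)) + |D| * Real.exp (-(min c d * t)) := by
        gcongr <;> exact le_abs_self _
    _ = _ := by ring

theorem const_mul (a : ℝ) (hf : ExpSmall f) : ExpSmall fun t => a * f t :=
  hf.of_le (K := |a|) fun _ _ => (abs_mul _ _).le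

theorem abs (hf : ExpSmall f) : ExpSmall fun t => |f t| :=
  hf.of_le (K := 1) fun t _ => by simp

theorem sub (hf : ExpSmall f) (hg : ExpSmall g) : ExpSmall fun t => f t - g t := by
  simpa [sub_eq_add_neg] using hf.add (hg.const_mul (-1))

theorem sum {ι : Type*} (s : Finset ι) {F : ι → ℝ → ℝ} (h : ∀ i ∈ s, ExpSmall (F i)) :
    ExpSmall fun t => ∑ i ∈ s, F i t := by
  classical
  induction s using Finset.induction_on with
  | empty => simpa using zero
  | insert a s ha ih =>
    simp only [Finset.sum_insert ha]
    exact (h a (by simp)).add (ih fun i hi => h i (by simp [hi]))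

/-- A function with an exponentially small square is exponentially small, at half the rate. -/
theorem of_sq (h : ExpSmall fun t => f t ^ 2) : ExpSmall f := by
  obtain ⟨C, c, hc, hC⟩ := h
  refine ⟨√C, c / 2, by positivity, fun t ht => ?_⟩
  have h1 := hC t ht
  rw [abs_of_nonneg (sq_nonneg _)] at h1
  have hC0 : 0 ≤ C := by
    by_contra hneg
    nlinarith [sq_nonneg (f t), Real.exp_pos (-(c * t))]
  have h2 : Real.exp (-(c * t)) = Real.exp (-(c / 2 * t)) ^ 2 := by
    rw [← Real.exp_nat_mul]; congr 1; push_cast; ring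
  refine abs_le_of_sq_le_sq (h1.trans_eq ?_) (by positivity)
  rw [mul_pow, Real.sq_sqrt hC0, h2]

theorem mul_id_bounded (hf : ExpSmall f) : ∃ K, ∀ t, 0 ≤ t → |t * f t| ≤ K := by
  obtain ⟨C, c, hc, hC⟩ := hf
  refine ⟨|C| / c, fun t ht => ?_⟩
  have h1 : c * t * Real.exp (-(c * t)) ≤ 1 := by
    rw [Real.exp_neg, ← div_eq_mul_inv, div_le_one (Real.exp_pos _)]
    linarith [Real.add_one_le_exp (c * t)]
  rw [le_div_iff₀ hc, abs_mul, abs_of_nonneg ht]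
  calc t * |f t| * c ≤ t * (|C| * Real.exp (-(c * t))) * c := by
        gcongr
        exact (hC t ht).trans (by gcongr; exact le_abs_self C)
    _ = |C| * (c * t * Real.exp (-(c * t))) := by ring
    _ ≤ |C| * 1 := by gcongr
    _ = |C| := mul_one _

/-- The quantitative Cauchy criterion: increments with an exponentially small square force
exponential convergence. -/
theorem exists_limit {x r : ℝ → ℝ} (hr : ExpSmall r)
    (h : ∀ s t, 0 ≤ s → 0 ≤ t → (x s - x t) ^ 2 ≤ |r s| + |r t|) :
    ∃ z, Filter.Tendsto x Filter.atTop (nhds z) ∧ ExpSmall fun t => x t - z := by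
  obtain ⟨C, c, hc, hC⟩ := hr
  have hr0 : Filter.Tendsto (fun t => |r t|) Filter.atTop (nhds 0) := by
    have h1 : Filter.Tendsto (fun t : ℝ => C * Real.exp (-(c * t))) Filter.atTop (nhds 0) := by
      have := (Real.tendsto_exp_neg_atTop_nhds_zero.comp
        (Filter.tendsto_id.const_mul_atTop hc)).const_mul C
      simpa using this
    refine squeeze_zero' (Filter.Eventually.of_forall fun t => abs_nonneg _) ?_ h1
    filter_upwards [Filter.eventually_ge_atTop 0] with t ht using hC t ht
  have hcau : Cauchy (Filter.map x Filter.atTop) := by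
    rw [Metric.cauchy_iff]
    refine ⟨inferInstance, fun ε hε => ?_⟩
    have h2 : ∀ᶠ t in Filter.atTop, |r t| < ε ^ 2 / 2 :=
      hr0.eventually (gt_mem_nhds (by positivity))
    refine ⟨x '' {t | 0 ≤ t ∧ |r t| < ε ^ 2 / 2},
      Filter.image_mem_map ((Filter.eventually_ge_atTop 0).and h2), ?_⟩
    rintro _ ⟨s, ⟨hs, hs'⟩, rfl⟩ _ ⟨t, ⟨ht, ht'⟩, rfl⟩
    rw [Real.dist_eq]
    exact abs_lt_of_sq_lt_sq (by linarith [h s t hs ht]) hε.le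
  obtain ⟨z, hz⟩ := CompleteSpace.complete hcau
  refine ⟨z, hz, of_sq (of_abs_le (ExpSmall.abs ⟨C, c, hc, hC⟩) fun t ht => ?_)⟩
  rw [abs_of_nonneg (sq_nonneg _)]
  have hz' : Filter.Tendsto x Filter.atTop (nhds z) := hz
  have h3 : Filter.Tendsto (fun s => (x t - x s) ^ 2) Filter.atTop (nhds ((x t - z) ^ 2)) :=
    (tendsto_const_nhds.sub hz').pow 2
  have h4 : Filter.Tendsto (fun s => |r t| + |r s|) Filter.atTop (nhds (|r t| + 0)) :=
    hr0.const_add _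
  rw [add_zero] at h4
  refine le_of_tendsto_of_tendsto h3 h4 ?_
  filter_upwards [Filter.eventually_ge_atTop 0] with s hs using h t s ht hs

end ExpSmall

/-! ### Conformal decomposition -/

variable {E : Type*} [Fintype E]

/-- Every subspace of `ℝ^E` has finitely many generators such that each of its vectors `h` is a
nonnegative combination of them without cancellation: in every coordinate, every summand lies
between `0` and the coordinate of `h`. One generator per realised sign pattern suffices: subtracting
the largest admissible multiple of the generator with the signs of `h` shrinks the support. -/
theorem exists_conformal_generators [DecidableEq E] (W : Submodule ℝ (E → ℝ)) :
    ∃ C : (E → SignType) → E → ℝ, (∀ s, C s ∈ W) ∧ ∀ h ∈ W, ∃ a : (E → SignType) → ℝ,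
      (∀ s, 0 ≤ a s) ∧ (∀ e, h e = ∑ s, a s * C s e) ∧
      ∀ s e, min 0 (h e) ≤ a s * C s e ∧ a s * C s e ≤ max 0 (h e) := by
  classical
  have key : ∀ s : E → SignType, ∃ c ∈ W, ∀ h ∈ W, (∀ e, SignType.sign (h e) = s e) →
      ∀ e, SignType.sign (c e) = s e := by
    intro s
    by_cases hs : ∃ c ∈ W, ∀ e, SignType.sign (c e) = s e
    · obtain ⟨c, hc, h⟩ := hs
      exact ⟨c, hc, fun _ _ _ => h⟩
    · exact ⟨0, W.zero_mem, fun h hh hs' => absurd ⟨h, hh, hs'⟩ hs⟩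
  choose C hCW hC using key
  refine ⟨C, hCW, ?_⟩
  -- Induction on the size of the support of `h`.
  suffices H : ∀ n : ℕ, ∀ h ∈ W, (Finset.univ.filter fun e => h e ≠ 0).card ≤ n →
      ∃ a : (E → SignType) → ℝ, (∀ s, 0 ≤ a s) ∧ (∀ e, h e = ∑ s, a s * C s e) ∧
      ∀ s e, min 0 (h e) ≤ a s * C s e ∧ a s * C s e ≤ max 0 (h e) from
    fun h hh => H _ h hh le_rfl
  intro n
  induction n with
  | zero =>
    intro h _ hcard
    have h0 : ∀ e, h e = 0 := by
      intro e
      by_contra he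
      have : e ∈ Finset.univ.filter fun e => h e ≠ 0 := by simp [he]
      rw [Nat.le_zero, Finset.card_eq_zero] at hcard
      simp [hcard] at this
    exact ⟨fun _ => 0, fun _ => le_rfl, fun e => by simp [h0], fun s e => by simp [h0]⟩
  | succ n ih =>
    intro h hh hcard
    by_cases hne : (Finset.univ.filter fun e => h e ≠ 0).Nonempty
    swap
    · rw [Finset.not_nonempty_iff_eq_empty] at hne
      exact ih h hh (by simp [hne])
    set s : E → SignType := fun e => SignType.sign (h e)
    have hsign : ∀ e, SignType.sign (C s e) = SignType.sign (h e) := hC s h hh fun _ => rfl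
    have hpos : ∀ e, 0 < h e → 0 < C s e := fun e he => by
      have := hsign e
      rwa [sign_pos he, sign_eq_one_iff] at this
    have hneg : ∀ e, h e < 0 → C s e < 0 := fun e he => by
      have := hsign e
      rwa [sign_neg he, sign_eq_neg_one_iff] at this
    have hzero : ∀ e, h e = 0 → C s e = 0 := fun e he => by
      have := hsign e
      rwa [he, sign_zero, sign_eq_zero_iff] at this
    obtain ⟨e₀, he₀, hmin⟩ := Finset.exists_min_image _ (fun e => h e / C s e) hne
    simp only [Finset.mem_filter, Finset.mem_univ, true_and] at he₀ hmin
    -- `r` is the largest multiple of `C s` that can be subtracted without a change of sign.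
    set r := h e₀ / C s e₀ with hr
    have hr0 : 0 < r := by
      rcases lt_or_gt_of_ne he₀ with h1 | h1
      · exact div_pos_of_neg_of_neg h1 (hneg _ h1)
      · exact div_pos h1 (hpos _ h1)
    have hle : ∀ e, 0 < h e → 0 ≤ r * C s e ∧ r * C s e ≤ h e := fun e he =>
      ⟨(mul_pos hr0 (hpos e he)).le, (le_div_iff₀ (hpos e he)).1 (hmin e he.ne')⟩
    have hge : ∀ e, h e < 0 → r * C s e ≤ 0 ∧ h e ≤ r * C s e := fun e he =>
      ⟨(mul_neg_of_pos_of_neg hr0 (hneg e he)).le, (le_div_iff_of_neg (hneg e he)).1 (hmin e he.ne)⟩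
    have hr1 : r * C s e₀ = h e₀ := by
      rw [hr, div_mul_cancel₀]
      rcases lt_or_gt_of_ne he₀ with h1 | h1
      · exact (hneg _ h1).ne
      · exact (hpos _ h1).ne'
    obtain ⟨a, ha, hsum, hconf⟩ := ih (h - r • C s) (W.sub_mem hh (W.smul_mem _ (hCW s))) (by
      have : (Finset.univ.filter fun e => (h - r • C s) e ≠ 0) ⊂
          Finset.univ.filter fun e => h e ≠ 0 := by
        rw [Finset.ssubset_iff_of_subset]
        · exact ⟨e₀, by simp [he₀], by simp [hr1]⟩
        · intro e
          simp only [Finset.mem_filter, Finset.mem_univ, true_and]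
          intro h1 h2
          exact h1 (by simp [h2, hzero e h2])
      have := Finset.card_lt_card this
      omega)
    simp only [Pi.sub_apply, Pi.smul_apply, smul_eq_mul] at hsum hconf
    refine ⟨fun s' => a s' + if s' = s then r else 0, fun s' => ?_, fun e => ?_, fun s' e => ?_⟩
    · have := ha s'
      dsimp only
      split_ifs <;> linarith
    · simp only [add_mul, Finset.sum_add_distrib, ← hsum e, ite_mul, zero_mul,
        Finset.sum_ite_eq', Finset.mem_univ, if_true]
      ring
    · have h1 := hconf s' e
      dsimp only
      rcases lt_trichotomy (h e) 0 with he | he | he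
      · obtain ⟨h2, h3⟩ := hge e he
        rw [min_eq_right (by linarith), max_eq_left (by linarith)] at h1
        rw [min_eq_right he.le, max_eq_left he.le]
        split_ifs with h4
        · subst h4; constructor <;> linarith
        · constructor <;> linarith
      · rw [he, hzero e he] at h1
        rw [he]
        split_ifs with h4
        · subst h4; rw [hzero e he]; simp
        · simpa using h1
      · obtain ⟨h2, h3⟩ := hle e he
        rw [min_eq_left (by linarith), max_eq_right (by linarith)] at h1
        rw [min_eq_left he.le, max_eq_right he.le]
        split_ifs with h4
        · subst h4; constructor <;> linarith
        · constructor <;> linarith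

/-- A vector of `W` that is small on a set `Z` of coordinates is close to a vector of `W` that
vanishes on `Z`: drop the conformal generators that do not vanish on `Z`. -/
theorem exists_vanishing_near (W : Submodule ℝ (E → ℝ)) (Z : Finset E) :
    ∃ K, ∀ h ∈ W, ∃ w ∈ W, (∀ e ∈ Z, w e = 0) ∧
      ∀ e, |h e - w e| ≤ K * ∑ e' ∈ Z, |h e'| := by
  classical
  cases isEmpty_or_nonempty E
  · exact ⟨0, fun h hh => ⟨h, hh, fun e => isEmptyElim e, fun e => isEmptyElim e⟩⟩
  obtain ⟨C, hCW, hC⟩ := exists_conformal_generators W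
  let good : Finset (E → SignType) := Finset.univ.filter fun s => ∀ e ∈ Z, C s e = 0
  have hbad : ∀ s, s ∉ good → ∃ e ∈ Z, C s e ≠ 0 := by
    intro s hs
    simpa [good] using hs
  choose! i hiH hi using hbad
  refine ⟨∑ s, ∑ e, |C s e| / |C s (i s)|, fun h hh => ?_⟩
  obtain ⟨a, ha, hsum, hconf⟩ := hC h hh
  refine ⟨∑ s ∈ good, a s • C s, W.sum_mem fun s _ => W.smul_mem _ (hCW s), fun e he => ?_,
    fun e => ?_⟩
  · rw [Finset.sum_apply]
    refine Finset.sum_eq_zero fun s hs => ?_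
    have : C s e = 0 := (Finset.mem_filter.1 hs).2 e he
    simp [this]
  set N := ∑ e' ∈ Z, |h e'| with hN
  have hN0 : 0 ≤ N := Finset.sum_nonneg fun _ _ => abs_nonneg _
  have habs : ∀ s e, a s * |C s e| ≤ |h e| := by
    intro s e
    rw [← abs_of_nonneg (ha s), ← abs_mul, abs_le]
    obtain ⟨h1, h2⟩ := hconf s e
    exact ⟨(le_min (by simp) (neg_abs_le _)).trans h1, h2.trans (max_le (by simp) (le_abs_self _))⟩
  have heq : h e - (∑ s ∈ good, a s • C s) e = ∑ s ∈ goodᶜ, a s * C s e := by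
    rw [hsum e, ← Finset.sum_add_sum_compl good, Finset.sum_apply]
    simp
  rw [heq, Finset.sum_mul]
  calc |∑ s ∈ goodᶜ, a s * C s e| ≤ ∑ s ∈ goodᶜ, |a s * C s e| := Finset.abs_sum_le_sum_abs _ _
    _ ≤ ∑ s ∈ goodᶜ, (∑ e, |C s e| / |C s (i s)|) * N := by
        refine Finset.sum_le_sum fun s hs => ?_
        rw [Finset.mem_compl] at hs
        have hpos : 0 < |C s (i s)| := abs_pos.2 (hi s hs)
        have h1 : a s ≤ N / |C s (i s)| := by
          rw [le_div_iff₀ hpos]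
          exact (habs s (i s)).trans (Finset.single_le_sum (f := fun e' => |h e'|)
            (fun _ _ => abs_nonneg _) (hiH s hs))
        have h2 : |C s e| / |C s (i s)| ≤ ∑ e, |C s e| / |C s (i s)| :=
          Finset.single_le_sum (f := fun e => |C s e| / |C s (i s)|)
            (fun _ _ => by positivity) (Finset.mem_univ e)
        rw [abs_mul, abs_of_nonneg (ha s)]
        calc a s * |C s e| ≤ N / |C s (i s)| * |C s e| := by gcongr
          _ = |C s e| / |C s (i s)| * N := by ring
          _ ≤ _ := by gcongr
    _ ≤ ∑ s, (∑ e, |C s e| / |C s (i s)|) * N :=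
        Finset.sum_le_univ_sum_of_nonneg fun s =>
          mul_nonneg (Finset.sum_nonneg fun _ _ => by positivity) hN0

/-! ### Entropic paths -/

/-- The point `(1 - e⁻ᵗ) f + e⁻ᵗ s`, which has the same imbalance as the conductivities at time
`t` if these start at `s` and `f` is a flow. -/
noncomputable def comparison {E : Type*} (f s : E → ℝ) (t : ℝ) : E → ℝ :=
  fun e => (1 - Real.exp (-t)) * f e + Real.exp (-t) * s e

theorem comparison_of_eq_zero {E : Type*} {f s : E → ℝ} (t : ℝ) {e : E} (he : f e = 0) :
    comparison f s t e = Real.exp (-t) * s e := by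
  simp [comparison, he]

theorem min_le_comparison {E : Type*} (f s : E → ℝ) {t : ℝ} (ht : 0 ≤ t) (e : E) :
    min (f e) (s e) ≤ comparison f (s) t e := by
  have h1 : Real.exp (-t) ≤ 1 := Real.exp_le_one_iff.2 (by linarith)
  have h2 := Real.exp_pos (-t)
  have h3 := min_le_left (f e) (s e)
  have h4 := min_le_right (f e) (s e)
  unfold comparison
  nlinarith

/-- The exact form of the conductivities of a Physarum solver: relative to the space `W` of
circulations and a cost-minimal flow `f` of full support, `σ t` lies in the coset `comparison + W`
and satisfies there the stationarity condition of the linear programme with cost `l`, regularised by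
`1 / t` times the entropy `∑ l (σ log (σ / σ(0)) - σ)`. The field `opt` says that a circulation which
may be added to `f` has nonnegative cost, and that it is supported in `supp f` if its cost is zero. -/
structure EntropicPath {E : Type*} [Fintype E] (W : Submodule ℝ (E → ℝ)) (l f : E → ℝ)
    (σ : ℝ → E → ℝ) : Prop where
  l_pos : ∀ e, 0 < l e
  f_nonneg : ∀ e, 0 ≤ f e
  opt : ∀ h ∈ W, (∀ e, f e = 0 → 0 ≤ h e) →
    0 ≤ l ⬝ᵥ h ∧ (l ⬝ᵥ h = 0 → ∀ e, f e = 0 → h e = 0)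
  pos : ∀ t, 0 ≤ t → ∀ e, 0 < σ t e
  mem : ∀ t, 0 ≤ t → σ t - comparison f (σ 0) t ∈ W
  log : ∀ t, 0 ≤ t → ∀ h ∈ W, ∑ e, l e * h e * Real.log (σ t e / σ 0 e) = -(t * l ⬝ᵥ h)

/-- The coercivity of the entropy: for bounded `g`, the function `(x - g) log (x / s)` exceeds `x` up
to a constant. It follows from `log y ≤ y - 1` at `y = e s / x` and at `y = x / M`. -/
theorem sub_le_mul_log {x s g M : ℝ} (hx : 0 < x) (hs : 0 < s) (hg : 0 ≤ g) (hgM : g ≤ M)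
    (hM : 0 < M) :
    x - (Real.exp 1 * s + M * |1 + Real.log (s / M)|) ≤ (x - g) * Real.log (x / s) := by
  have h1 : 2 * x - Real.exp 1 * s ≤ x * Real.log (x / s) := by
    have h := Real.log_le_sub_one_of_pos (show 0 < Real.exp 1 * s / x by positivity)
    rw [Real.log_div (by positivity) hx.ne', Real.log_mul (by positivity) hs.ne',
      Real.log_exp] at h
    rw [Real.log_div hx.ne' hs.ne']
    have h2 : x * (Real.exp 1 * s / x) = Real.exp 1 * s := by field_simp
    nlinarith
  have h2 : g * Real.log (x / s) ≤ x + M * |1 + Real.log (s / M)| := by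
    have h := Real.log_le_sub_one_of_pos (show 0 < x / M by positivity)
    rw [Real.log_div hx.ne' hM.ne'] at h
    have h3 : Real.log (x / s) ≤ x / M + |1 + Real.log (s / M)| := by
      rw [Real.log_div hx.ne' hs.ne']
      have := neg_abs_le (1 + Real.log (s / M))
      rw [Real.log_div hs.ne' hM.ne'] at this ⊢
      linarith
    calc g * Real.log (x / s) ≤ g * (x / M + |1 + Real.log (s / M)|) := by gcongr
      _ ≤ M * (x / M + |1 + Real.log (s / M)|) := by gcongr
      _ = _ := by field_simp
  linarith

/-- The strong monotonicity of the logarithm on `(0, M]`. -/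
theorem sq_div_le_mul_log_sub {a b M : ℝ} (ha : 0 < a) (hb : 0 < b) (haM : a ≤ M) (hbM : b ≤ M) :
    (a - b) ^ 2 / M ≤ (a - b) * (Real.log a - Real.log b) := by
  wlog hab : b ≤ a generalizing a b
  · have := this hb ha hbM haM (le_of_not_ge hab)
    calc (a - b) ^ 2 / M = (b - a) ^ 2 / M := by ring
      _ ≤ _ := this
      _ = _ := by ring
  have h := Real.log_le_sub_one_of_pos (div_pos hb ha)
  rw [Real.log_div hb.ne' ha.ne'] at h
  have h1 : (a - b) / M ≤ Real.log a - Real.log b := by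
    calc (a - b) / M ≤ (a - b) / a := by gcongr
      _ = 1 - b / a := by field_simp
      _ ≤ _ := by linarith
  calc (a - b) ^ 2 / M = (a - b) * ((a - b) / M) := by ring
    _ ≤ _ := by gcongr

namespace EntropicPath

variable {E : Type*} [Fintype E] {W : Submodule ℝ (E → ℝ)} {l f : E → ℝ} {σ : ℝ → E → ℝ}

theorem comparison_nonneg (H : EntropicPath W l f σ) {t : ℝ} (ht : 0 ≤ t) (e : E) :
    0 ≤ comparison f (σ 0) t e := by
  have h1 : Real.exp (-t) ≤ 1 := Real.exp_le_one_iff.2 (by linarith)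
  have h2 := Real.exp_pos (-t)
  exact add_nonneg (mul_nonneg (by linarith) (H.f_nonneg e)) (mul_nonneg h2.le (H.pos 0 le_rfl e).le)

theorem comparison_le (H : EntropicPath W l f σ) {t : ℝ} (ht : 0 ≤ t) (e : E) :
    comparison f (σ 0) t e ≤ f e + σ 0 e := by
  have h1 : Real.exp (-t) ≤ 1 := Real.exp_le_one_iff.2 (by linarith)
  have h2 := Real.exp_pos (-t)
  have h3 := H.f_nonneg e
  have h4 := H.pos 0 le_rfl e
  unfold comparison
  nlinarith

theorem log_sub_comparison (H : EntropicPath W l f σ) {t : ℝ} (ht : 0 ≤ t) :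
    ∑ e, l e * (σ t e - comparison f (σ 0) t e) * Real.log (σ t e / σ 0 e) =
      -(t * l ⬝ᵥ (σ t - comparison f (σ 0) t)) :=
  H.log t ht _ (H.mem t ht)

/-- The conductivities stay bounded: superlinear growth of the entropy makes this hold from `t = 0`
on, where the cost term alone gives no control. -/
theorem bounded_above (H : EntropicPath W l f σ) (e : E) :
    ∃ M, 0 < M ∧ ∀ t, 0 ≤ t → σ t e ≤ M := by
  have hs := H.pos 0 le_rfl
  have hMpos : ∀ e, 0 < f e + σ 0 e := fun e => add_pos_of_nonneg_of_pos (H.f_nonneg e) (hs e)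
  set k : E → ℝ := fun e => Real.exp 1 * σ 0 e +
    (f e + σ 0 e) * |1 + Real.log (σ 0 e / (f e + σ 0 e))| with hk
  have hk0 : ∀ e, 0 < k e := fun e => by
    have := hMpos e
    have := hs e
    positivity
  set K := ∑ e, l e * k e with hK
  set D := ∑ e, l e * (f e + σ 0 e) with hD
  have hK0 : 0 < K := Finset.sum_pos (fun e _ => mul_pos (H.l_pos e) (hk0 e)) ⟨e, Finset.mem_univ e⟩
  have hD0 : 0 < D :=
    Finset.sum_pos (fun e _ => mul_pos (H.l_pos e) (hMpos e)) ⟨e, Finset.mem_univ e⟩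
  refine ⟨(K + D) / l e, div_pos (by linarith) (H.l_pos e), fun t ht => ?_⟩
  have h1 : ∑ e, l e * (σ t e - k e) ≤
      ∑ e, l e * (σ t e - comparison f (σ 0) t e) * Real.log (σ t e / σ 0 e) := by
    refine Finset.sum_le_sum fun e _ => ?_
    rw [mul_assoc]
    exact mul_le_mul_of_nonneg_left (sub_le_mul_log (H.pos t ht e) (hs e)
      (H.comparison_nonneg ht e) (H.comparison_le ht e) (hMpos e)) (H.l_pos e).le
  rw [H.log_sub_comparison ht, dotProduct_sub] at h1
  have h2 : l ⬝ᵥ comparison f (σ 0) t ≤ D :=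
    Finset.sum_le_sum fun e _ => mul_le_mul_of_nonneg_left (H.comparison_le ht e) (H.l_pos e).le
  have h3 : ∑ e, l e * (σ t e - k e) = l ⬝ᵥ σ t - K := by
    simp [mul_sub, Finset.sum_sub_distrib, dotProduct, hK]
  rw [h3] at h1
  have h4 : l ⬝ᵥ σ t ≤ K + D := by
    -- The entropy supplies the `1` in `1 + t`, so that no lower bound on `t` is needed.
    have h5 : (1 + t) * (l ⬝ᵥ σ t) ≤ (1 + t) * (K + D) := by nlinarith
    exact le_of_mul_le_mul_left h5 (by linarith)
  rw [le_div_iff₀ (H.l_pos e), mul_comm]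
  exact (Finset.single_le_sum (f := fun e => l e * σ t e)
    (fun e _ => (mul_pos (H.l_pos e) (H.pos t ht e)).le) (Finset.mem_univ e)).trans h4

/-- Off the support of `f` the conductivities are exponentially small. In a conformal decomposition
of `σ t - comparison` into circulations `c`, those with a negative entry off `supp f` have a tiny
coefficient because that entry is bounded by `e⁻ᵗ σ(0)`; the others that are not supported in
`supp f` have positive cost, so the stationarity condition forces the positive entries of `c`, and
with them the coefficient, to decay exponentially. -/
theorem expSmall_of_eq_zero (H : EntropicPath W l f σ) {e : E} (he : f e = 0) :
    ExpSmall fun t => σ t e := by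
  classical
  obtain ⟨C, hCW, hC⟩ := exists_conformal_generators W
  have hs := H.pos 0 le_rfl
  have hC' : ∀ t : ℝ, 0 ≤ t → _ := fun t ht => hC _ (H.mem t ht)
  choose! a ha hsum hconf using hC'
  simp only [Pi.sub_apply] at hsum hconf
  choose M hM0 hM using H.bounded_above
  have hterm : ∀ c, ExpSmall fun t => a t c * C c e := by
    intro c
    by_cases hvan : ∀ e, f e = 0 → C c e = 0
    · simpa [hvan e he] using ExpSmall.zero
    have hsmall : ExpSmall fun t => a t c := by
      by_cases hneg : ∃ e, f e = 0 ∧ C c e < 0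
      · obtain ⟨i, hi, hCi⟩ := hneg
        refine ExpSmall.exp_neg.of_le (K := σ 0 i / -C c i) fun t ht => ?_
        have h1 := (hconf t ht c i).1
        have h2 : -(Real.exp (-t) * σ 0 i) ≤ a t c * C c i := by
          refine le_trans (le_min ?_ ?_) h1
          · have := mul_pos (Real.exp_pos (-t)) (hs i)
            linarith
          · rw [comparison_of_eq_zero t hi]
            linarith [H.pos t ht i]
        rw [abs_of_nonneg (ha t ht c), abs_of_pos (Real.exp_pos _), div_mul_eq_mul_div,
          le_div_iff₀ (by linarith)]
        linarith
      · push Not at hneg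
        have hcost : 0 < l ⬝ᵥ C c := by
          obtain ⟨h1, h2⟩ := H.opt _ (hCW c) hneg
          exact lt_of_le_of_ne h1 fun h3 => hvan (h2 h3.symm)
        set A := ∑ e, l e * max 0 (C c e) with hA
        have hA0 : 0 < A := hcost.trans_le
          (Finset.sum_le_sum fun e _ => mul_le_mul_of_nonneg_left (le_max_right _ _) (H.l_pos e).le)
        set k : E → ℝ := fun e =>
          l e * |C c e| * (|Real.log (C c e / σ 0 e)| + |Real.log (M e / σ 0 e)|) with hk
        refine ⟨Real.exp ((∑ e, k e) / A), l ⬝ᵥ C c / A, by positivity, fun t ht => ?_⟩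
        rw [abs_of_nonneg (ha t ht c), ← Real.exp_add]
        rcases (ha t ht c).eq_or_lt with h0 | h0
        · rw [← h0]; positivity
        rw [← Real.log_le_iff_le_exp h0]
        -- Conformality gives `a t c * C c e ≤ σ t e` on the positive entries, the negative ones are
        -- handled by the upper bound on `σ`; this bounds the logarithm of the coefficient.
        have h1 : ∑ e, (l e * max 0 (C c e) * Real.log (a t c) - k e) ≤
            ∑ e, l e * C c e * Real.log (σ t e / σ 0 e) := by
          refine Finset.sum_le_sum fun e _ => ?_
          have hl := H.l_pos e
          have hσ := H.pos t ht e
          rcases le_or_gt (C c e) 0 with hCe | hCe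
          · have h2 : Real.log (σ t e / σ 0 e) ≤ |Real.log (M e / σ 0 e)| :=
              (Real.log_le_log (div_pos hσ (hs e))
                (div_le_div_of_nonneg_right (hM e t ht) (hs e).le)).trans (le_abs_self _)
            rw [max_eq_left hCe]
            simp only [hk, abs_of_nonpos hCe]
            have h3 : 0 ≤ l e * -C c e := mul_nonneg hl.le (by linarith)
            have h4 := mul_le_mul_of_nonneg_left h2 h3
            have h5 := mul_nonneg h3 (abs_nonneg (Real.log (C c e / σ 0 e)))
            linarith
          · have h2 : a t c * C c e ≤ σ t e := by
              refine (hconf t ht c e).2.trans (max_le hσ.le ?_)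
              linarith [H.comparison_nonneg ht e]
            have h3 : Real.log (a t c) + Real.log (C c e / σ 0 e) ≤ Real.log (σ t e / σ 0 e) := by
              rw [← Real.log_mul h0.ne' (div_pos hCe (hs e)).ne', ← mul_div_assoc]
              exact Real.log_le_log (div_pos (mul_pos h0 hCe) (hs e))
                (div_le_div_of_nonneg_right h2 (hs e).le)
            rw [max_eq_right hCe.le]
            simp only [hk, abs_of_pos hCe]
            have h4 : 0 ≤ l e * C c e := (mul_pos hl hCe).le
            have h5 := mul_le_mul_of_nonneg_left h3 h4
            have h6 := mul_le_mul_of_nonneg_left (neg_abs_le (Real.log (C c e / σ 0 e))) h4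
            have h7 := mul_nonneg h4 (abs_nonneg (Real.log (M e / σ 0 e)))
            linarith
        rw [H.log t ht _ (hCW c), Finset.sum_sub_distrib, ← Finset.sum_mul] at h1
        have h2 : Real.log (a t c) ≤ (∑ e, k e - t * l ⬝ᵥ C c) / A := by
          rw [le_div_iff₀ hA0]; linarith
        refine h2.trans_eq ?_
        ring
    simpa [mul_comm] using hsmall.const_mul (C c e)
  have h1 : ExpSmall fun t => ∑ c, a t c * C c e + σ 0 e * Real.exp (-t) :=
    (ExpSmall.sum Finset.univ fun c _ => hterm c).add (ExpSmall.exp_neg.const_mul _)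
  refine h1.of_le (K := 1) fun t ht => ?_
  rw [← hsum t ht e, comparison_of_eq_zero t he, one_mul]
  exact le_of_eq (congrArg _ (by ring))

theorem cost_eq_zero (H : EntropicPath W l f σ) {w : E → ℝ} (hw : w ∈ W)
    (h : ∀ e, f e = 0 → w e = 0) : l ⬝ᵥ w = 0 := by
  have h1 := (H.opt w hw fun e he => (h e he).ge).1
  have h2 := (H.opt (-w) (W.neg_mem hw) fun e he => by simp [h e he]).1
  rw [dotProduct_neg] at h2
  linarith

/-- The cost of a circulation is controlled by its entries off the support of `f`. -/
theorem exists_abs_cost_le (H : EntropicPath W l f σ) :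
    ∃ K, ∀ h ∈ W, |l ⬝ᵥ h| ≤ K * ∑ e with f e = 0, |h e| := by
  obtain ⟨K, hK⟩ := exists_vanishing_near W (Finset.univ.filter fun e => f e = 0)
  refine ⟨∑ e, l e * K, fun h hh => ?_⟩
  obtain ⟨w, hw, hw0, hle⟩ := hK h hh
  have h1 : l ⬝ᵥ h = ∑ e, l e * (h e - w e) := by
    have h2 := H.cost_eq_zero hw fun e he => hw0 e (by simp [he])
    have h3 : l ⬝ᵥ (h - w) = l ⬝ᵥ h := by rw [dotProduct_sub, h2, sub_zero]
    rw [← h3]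
    rfl
  rw [h1, Finset.sum_mul]
  refine (Finset.abs_sum_le_sum_abs _ _).trans (Finset.sum_le_sum fun e _ => ?_)
  rw [abs_mul, abs_of_pos (H.l_pos e), mul_assoc]
  exact mul_le_mul_of_nonneg_left (hle e) (H.l_pos e).le

theorem expSmall_sub_comparison (H : EntropicPath W l f σ) {e : E} (he : f e = 0) :
    ExpSmall fun t => σ t e - comparison f (σ 0) t e := by
  simpa [comparison_of_eq_zero _ he, mul_comm] using
    (H.expSmall_of_eq_zero he).sub (ExpSmall.exp_neg.const_mul (σ 0 e))

/-- On the support of `f` the conductivities are bounded away from zero. -/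
theorem bounded_below (H : EntropicPath W l f σ) {e : E} (he : f e ≠ 0) :
    ∃ m, 0 < m ∧ ∀ t, 0 ≤ t → m ≤ σ t e := by
  have hs := H.pos 0 le_rfl
  choose M hM0 hM using H.bounded_above
  obtain ⟨K, hK⟩ := H.exists_abs_cost_le
  -- The suboptimality gap beats the factor `t` in the stationarity condition.
  have hgap : ExpSmall fun t => l ⬝ᵥ (σ t - comparison f (σ 0) t) := by
    have h1 : ExpSmall fun t => ∑ e with f e = 0, |σ t e - comparison f (σ 0) t e| :=
      ExpSmall.sum _ fun e he => (H.expSmall_sub_comparison (by simpa using he)).abs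
    refine h1.of_le (K := K) fun t ht => (hK _ (H.mem t ht)).trans_eq ?_
    rw [abs_of_nonneg (Finset.sum_nonneg fun _ _ => abs_nonneg _)]
    rfl
  obtain ⟨D, hD⟩ := hgap.mul_id_bounded
  set q : E → ℝ := fun e => l e * ((f e + σ 0 e) * |Real.log (M e / σ 0 e)|) with hq
  have hq0 : ∀ e, 0 ≤ q e := fun e => mul_nonneg (H.l_pos e).le
    (mul_nonneg (add_nonneg (H.f_nonneg e) (hs e).le) (abs_nonneg _))
  have hterm : ∀ t, 0 ≤ t → ∀ e,
      l e * (comparison f (σ 0) t e * Real.log (σ t e / σ 0 e)) ≤ q e := by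
    intro t ht e
    refine mul_le_mul_of_nonneg_left ?_ (H.l_pos e).le
    have h2 : Real.log (σ t e / σ 0 e) ≤ |Real.log (M e / σ 0 e)| :=
      (Real.log_le_log (div_pos (H.pos t ht e) (hs e))
        (div_le_div_of_nonneg_right (hM e t ht) (hs e).le)).trans (le_abs_self _)
    exact (mul_le_mul_of_nonneg_left h2 (H.comparison_nonneg ht e)).trans
      (mul_le_mul_of_nonneg_right (H.comparison_le ht e) (abs_nonneg _))
  have hD0 : 0 ≤ D := (abs_nonneg _).trans (hD 0 le_rfl)
  set R := ∑ e, l e * σ 0 e + D + ∑ e, q e with hR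
  have hR0 : 0 ≤ R := add_nonneg (add_nonneg
    (Finset.sum_nonneg fun e _ => (mul_pos (H.l_pos e) (hs e)).le) hD0)
    (Finset.sum_nonneg fun e _ => hq0 e)
  have hlow : ∀ t, 0 ≤ t →
      -R ≤ l e * (comparison f (σ 0) t e * Real.log (σ t e / σ 0 e)) := by
    intro t ht
    have h1 := H.log_sub_comparison ht
    have h2 : ∑ e, l e * (σ t e - comparison f (σ 0) t e) * Real.log (σ t e / σ 0 e) =
        ∑ e, l e * (σ t e * Real.log (σ t e / σ 0 e)) -
          ∑ e, l e * (comparison f (σ 0) t e * Real.log (σ t e / σ 0 e)) := by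
      rw [← Finset.sum_sub_distrib]
      exact Finset.sum_congr rfl fun e _ => by ring
    have h3 : -∑ e, l e * σ 0 e ≤ ∑ e, l e * (σ t e * Real.log (σ t e / σ 0 e)) := by
      rw [← Finset.sum_neg_distrib]
      refine Finset.sum_le_sum fun e _ => ?_
      rw [← mul_neg]
      refine mul_le_mul_of_nonneg_left ?_ (H.l_pos e).le
      have h4 := Real.one_sub_inv_le_log_of_pos (div_pos (H.pos t ht e) (hs e))
      have h5 := mul_le_mul_of_nonneg_left h4 (H.pos t ht e).le
      have h6 : σ t e * (1 - (σ t e / σ 0 e)⁻¹) = σ t e - σ 0 e := by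
        have := (H.pos t ht e).ne'
        rw [inv_div]
        field_simp
      linarith [H.pos t ht e]
    have h4 := Finset.single_le_sum
      (f := fun e => q e - l e * (comparison f (σ 0) t e * Real.log (σ t e / σ 0 e)))
      (fun i _ => sub_nonneg.2 (hterm t ht i)) (Finset.mem_univ e)
    rw [Finset.sum_sub_distrib] at h4
    have h5 := (abs_le.1 (hD t ht)).1
    have h6 := hq0 e
    linarith
  set μ := min (f e) (σ 0 e) with hμ
  have hμ0 : 0 < μ := lt_min ((H.f_nonneg e).lt_of_ne' he) (hs e)
  refine ⟨σ 0 e * Real.exp (-(R / (l e * μ))), by have := hs e; positivity, fun t ht => ?_⟩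
  have hle : -(R / (l e * μ)) ≤ Real.log (σ t e / σ 0 e) := by
    rcases le_or_gt 0 (Real.log (σ t e / σ 0 e)) with hu | hu
    · have : 0 ≤ R / (l e * μ) := div_nonneg hR0 (mul_pos (H.l_pos e) hμ0).le
      linarith
    · rw [← neg_div, div_le_iff₀ (mul_pos (H.l_pos e) hμ0)]
      have h1 := hlow t ht
      have h2 := mul_le_mul_of_nonpos_right (min_le_comparison f (σ 0) ht e) hu.le
      have h3 := mul_le_mul_of_nonneg_left h2 (H.l_pos e).le
      rw [← hμ] at h3
      linarith
  rw [Real.le_log_iff_exp_le (div_pos (H.pos t ht e) (hs e)), le_div_iff₀ (hs e)] at hle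
  linarith

/-! ### Convergence of the conductivities -/

/-- Up to an exponentially small error, the conductivities move in the coset of `f` modulo the
circulations supported in `supp f`. -/
theorem exists_decomposition (H : EntropicPath W l f σ) :
    ∃ w r : ℝ → E → ℝ, (∀ t, 0 ≤ t → w t ∈ W ∧ (∀ e, f e = 0 → w t e = 0) ∧
      ∀ e, σ t e = f e + w t e + r t e) ∧ ∀ e, ExpSmall fun t => r t e := by
  obtain ⟨K, hK⟩ := exists_vanishing_near W (Finset.univ.filter fun e => f e = 0)
  have hK' : ∀ t : ℝ, 0 ≤ t → _ := fun t ht => hK _ (H.mem t ht)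
  choose! w hw hw0 hle using hK'
  refine ⟨w, fun t e => σ t e - f e - w t e, fun t ht => ⟨hw t ht, fun e he =>
    hw0 t ht e (by simp [he]), fun e => by ring⟩, fun e => ?_⟩
  have h1 : ExpSmall fun t => K * ∑ e with f e = 0, |σ t e - comparison f (σ 0) t e| :=
    (ExpSmall.sum _ fun e he => (H.expSmall_sub_comparison (by simpa using he)).abs).const_mul K
  have h2 : ExpSmall fun t => σ t e - comparison f (σ 0) t e - w t e :=
    h1.of_abs_le fun t ht => hle t ht e
  have h3 := h2.add (ExpSmall.exp_neg.const_mul (σ 0 e - f e))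
  refine h3.of_le (K := 1) fun t _ => ?_
  rw [one_mul]
  refine le_of_eq (congrArg _ ?_)
  unfold comparison
  ring

/-- The conductivities converge exponentially. Two points of the path differ, up to small errors, by
a circulation supported in `supp f`, which is orthogonal to the difference of their logarithms; the
strict monotonicity of the logarithm turns this into a Cauchy estimate. -/
theorem exists_limit (H : EntropicPath W l f σ) :
    ∃ z : E → ℝ, z - f ∈ W ∧ (∀ e, f e = 0 → z e = 0) ∧ (∀ e, f e ≠ 0 → 0 < z e) ∧
      ∀ e, ExpSmall fun t => σ t e - z e := by
  choose M hM0 hM using H.bounded_above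
  choose! m hm0 hm using fun e (he : f e ≠ 0) => H.bounded_below he
  obtain ⟨w, r, hw, hr⟩ := H.exists_decomposition
  set U : E → ℝ := fun e => 2 * (|Real.log (m e)| + |Real.log (M e)|) with hU
  set R : ℝ → ℝ := fun t => ∑ e, l e * U e * |r t e| with hR
  have hRs : ExpSmall R := ExpSmall.sum _ fun e _ => (hr e).abs.const_mul _
  have hU0 : ∀ e, 0 ≤ U e := fun e => by positivity
  have hR0 : ∀ t, 0 ≤ R t := fun t => Finset.sum_nonneg fun e _ =>
    mul_nonneg (mul_nonneg (H.l_pos e).le (hU0 e)) (abs_nonneg _)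
  have hlog : ∀ e, f e ≠ 0 → ∀ t, 0 ≤ t →
      |Real.log (σ t e)| ≤ |Real.log (m e)| + |Real.log (M e)| := by
    intro e he t ht
    have h1 := Real.log_le_log (hm0 e he) (hm e he t ht)
    have h2 := Real.log_le_log (H.pos t ht e) (hM e t ht)
    rw [abs_le]
    constructor
    · linarith [neg_abs_le (Real.log (m e)), abs_nonneg (Real.log (M e))]
    · linarith [le_abs_self (Real.log (M e)), abs_nonneg (Real.log (m e))]
  have hinc : ∀ e, f e ≠ 0 → ∀ s t, 0 ≤ s → 0 ≤ t →
      (σ s e - σ t e) ^ 2 ≤ |M e / l e * R s| + |M e / l e * R t| := by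
    intro e he s t hs ht
    obtain ⟨hws, hws0, hσs⟩ := hw s hs
    obtain ⟨hwt, hwt0, hσt⟩ := hw t ht
    have hdW := W.sub_mem hws hwt
    have hcost := H.cost_eq_zero hdW fun e he => by simp [hws0 e he, hwt0 e he]
    have hz : ∑ e, l e * (w s e - w t e) * (Real.log (σ s e) - Real.log (σ t e)) = 0 := by
      have h1 := H.log s hs _ hdW
      have h2 := H.log t ht _ hdW
      rw [hcost, mul_zero, neg_zero] at h1 h2
      refine Eq.trans ?_ (sub_eq_zero.2 (h1.trans h2.symm))
      rw [← Finset.sum_sub_distrib]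
      refine Finset.sum_congr rfl fun e _ => ?_
      have h3 := (H.pos 0 le_rfl e).ne'
      rw [Real.log_div (H.pos s hs e).ne' h3, Real.log_div (H.pos t ht e).ne' h3, Pi.sub_apply]
      ring
    have hterm : ∀ e, f e ≠ 0 → l e * ((σ s e - σ t e) ^ 2 / M e) ≤
        l e * (w s e - w t e) * (Real.log (σ s e) - Real.log (σ t e)) +
          (l e * U e * |r s e| + l e * U e * |r t e|) := by
      intro e he
      have h1 := sq_div_le_mul_log_sub (H.pos s hs e) (H.pos t ht e) (hM e s hs) (hM e t ht)
      have h2 : (r s e - r t e) * (Real.log (σ s e) - Real.log (σ t e)) ≤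
          U e * |r s e| + U e * |r t e| := by
        refine (le_abs_self _).trans ?_
        rw [abs_mul, mul_comm, ← mul_add]
        refine mul_le_mul ?_ (abs_sub _ _) (abs_nonneg _) (hU0 e)
        refine (abs_sub _ _).trans ?_
        have := hlog e he s hs
        have := hlog e he t ht
        simp only [hU]
        linarith
      have h3 : σ s e - σ t e = (w s e - w t e) + (r s e - r t e) := by
        rw [hσs e, hσt e]; ring
      have h4 : (σ s e - σ t e) ^ 2 / M e ≤
          (w s e - w t e) * (Real.log (σ s e) - Real.log (σ t e)) +
            (U e * |r s e| + U e * |r t e|) := by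
        refine h1.trans ?_
        nth_rewrite 1 [h3]
        rw [add_mul]
        linarith
      have h5 := mul_le_mul_of_nonneg_left h4 (H.l_pos e).le
      linarith
    have hterm' : ∀ e, 0 ≤ l e * (w s e - w t e) * (Real.log (σ s e) - Real.log (σ t e)) +
          (l e * U e * |r s e| + l e * U e * |r t e|) := by
      intro e
      have hl := H.l_pos e
      by_cases he : f e = 0
      -- Both increments vanish here, although `log σ` is unbounded.
      · rw [hws0 e he, hwt0 e he]
        have := hU0 e
        simp only [sub_zero, mul_zero, zero_mul, zero_add]
        positivity
      · have := hM0 e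
        exact le_trans (by positivity) (hterm e he)
    have h1 := (hterm e he).trans (Finset.single_le_sum (f := fun e =>
      l e * (w s e - w t e) * (Real.log (σ s e) - Real.log (σ t e)) +
        (l e * U e * |r s e| + l e * U e * |r t e|)) (fun e _ => hterm' e) (Finset.mem_univ e))
    rw [Finset.sum_add_distrib, hz, zero_add, Finset.sum_add_distrib] at h1
    change _ ≤ R s + R t at h1
    have hMl : 0 < M e / l e := div_pos (hM0 e) (H.l_pos e)
    rw [abs_of_nonneg (mul_nonneg hMl.le (hR0 s)), abs_of_nonneg (mul_nonneg hMl.le (hR0 t)),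
      ← mul_add]
    have h2 := mul_le_mul_of_nonneg_left h1 hMl.le
    refine le_trans (le_of_eq ?_) h2
    have := (hM0 e).ne'
    have := (H.l_pos e).ne'
    field_simp
  have hlim : ∀ e, ∃ z, Filter.Tendsto (fun t => σ t e) Filter.atTop (nhds z) ∧
      ExpSmall fun t => σ t e - z := by
    intro e
    by_cases he : f e = 0
    · refine ExpSmall.exists_limit ((H.expSmall_of_eq_zero he).const_mul (M e)) ?_
      intro s t hs ht
      have h1 := H.pos s hs e
      have h2 := H.pos t ht e
      have h3 := hM e s hs
      have h4 := hM e t ht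
      have h5 := hM0 e
      rw [abs_of_pos (mul_pos h5 h1), abs_of_pos (mul_pos h5 h2)]
      nlinarith
    · exact ExpSmall.exists_limit (hRs.const_mul (M e / l e)) (hinc e he)
  choose z hz hzs using hlim
  refine ⟨z, ?_, fun e he => ?_, fun e he => ?_, hzs⟩
  · have h1 : Filter.Tendsto (fun t => σ t - comparison f (σ 0) t) Filter.atTop (nhds (z - f)) := by
      rw [tendsto_pi_nhds]
      intro e
      have hexp := Real.tendsto_exp_neg_atTop_nhds_zero
      have h2 := ((hexp.const_sub 1).mul_const (f e)).add (hexp.mul_const (σ 0 e))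
      simp only [sub_zero, one_mul, zero_mul, add_zero] at h2
      exact (hz e).sub h2
    refine W.closed_of_finiteDimensional.mem_of_tendsto h1 ?_
    filter_upwards [Filter.eventually_ge_atTop 0] with t ht using H.mem t ht
  · have h1 : ExpSmall fun _ => z e := by
      simpa using (H.expSmall_of_eq_zero he).sub (hzs e)
    obtain ⟨C, c, hc, hC⟩ := h1
    have h2 : Filter.Tendsto (fun t : ℝ => C * Real.exp (-(c * t))) Filter.atTop (nhds 0) := by
      have := (Real.tendsto_exp_neg_atTop_nhds_zero.comp
        (Filter.tendsto_id.const_mul_atTop hc)).const_mul C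
      simpa using this
    have h3 : |z e| ≤ 0 := ge_of_tendsto h2 (by
      filter_upwards [Filter.eventually_ge_atTop 0] with t ht using hC t ht)
    exact abs_nonpos_iff.1 h3
  · refine (hm0 e he).trans_le (ge_of_tendsto (hz e) ?_)
    filter_upwards [Filter.eventually_ge_atTop 0] with t ht using hm e he t ht

/-! ### Convergence of the current -/

/-- The energy of the current is bounded by that of `f`, hence uniformly in time. -/
theorem exists_energy_le (H : EntropicPath W l f σ) {ψ : ℝ → E → ℝ}
    (hψ : ∀ t, 0 ≤ t → ∀ h ∈ W, ∑ e, l e * h e * ψ t e = 0)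
    (hφ : ∀ t, 0 ≤ t → (fun e => σ t e * ψ t e) - f ∈ W) :
    ∃ K, ∀ t, 0 ≤ t → ∀ e, l e * (σ t e * ψ t e ^ 2) ≤ K := by
  choose! m hm0 hm using fun e (he : f e ≠ 0) => H.bounded_below he
  refine ⟨∑ e, l e * (f e ^ 2 / m e), fun t ht e => ?_⟩
  have h1 := hψ t ht _ (hφ t ht)
  have h2 : ∀ e, l e * (σ t e * ψ t e ^ 2) ≤
      2 * (l e * (σ t e * ψ t e - f e) * ψ t e) + l e * (f e ^ 2 / m e) := by
    intro e
    have hσ := H.pos t ht e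
    have h3 : 2 * (f e * ψ t e) ≤ σ t e * ψ t e ^ 2 + f e ^ 2 / m e := by
      by_cases he : f e = 0
      · rw [he]; simp; positivity
      · have h4 : f e ^ 2 / σ t e ≤ f e ^ 2 / m e :=
          div_le_div_of_nonneg_left (sq_nonneg _) (hm0 e he) (hm e he t ht)
        have h5 : 0 ≤ (σ t e * ψ t e - f e) ^ 2 / σ t e := by positivity
        have h6 : (σ t e * ψ t e - f e) ^ 2 / σ t e =
            σ t e * ψ t e ^ 2 - 2 * (f e * ψ t e) + f e ^ 2 / σ t e := by
          field_simp; ring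
        linarith
    have := mul_le_mul_of_nonneg_left h3 (H.l_pos e).le
    linarith
  calc l e * (σ t e * ψ t e ^ 2) ≤ ∑ e, l e * (σ t e * ψ t e ^ 2) :=
        Finset.single_le_sum (f := fun e => l e * (σ t e * ψ t e ^ 2)) (fun e _ => by
          have := H.pos t ht e
          have := H.l_pos e
          positivity) (Finset.mem_univ e)
    _ ≤ ∑ e, (2 * (l e * (σ t e * ψ t e - f e) * ψ t e) + l e * (f e ^ 2 / m e)) :=
        Finset.sum_le_sum fun e _ => h2 e
    _ = _ := by
        rw [Finset.sum_add_distrib, ← Finset.mul_sum]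
        simp only [Pi.sub_apply] at h1
        rw [h1]; ring

/-- The current converges exponentially to the limit `z` of the conductivities: the energy of the
circulation `z - φ` equals its pairing with `z / σ`, which differs from the cost of `z - φ` only by
terms that are exponentially small. -/
theorem expSmall_current_sub (H : EntropicPath W l f σ) {ψ : ℝ → E → ℝ}
    (hψ : ∀ t, 0 ≤ t → ∀ h ∈ W, ∑ e, l e * h e * ψ t e = 0)
    (hφ : ∀ t, 0 ≤ t → (fun e => σ t e * ψ t e) - f ∈ W) {z : E → ℝ} (hzW : z - f ∈ W)
    (hz0 : ∀ e, f e = 0 → z e = 0) (hz : ∀ e, ExpSmall fun t => σ t e - z e) (e : E) :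
    ExpSmall fun t => σ t e * ψ t e - z e := by
  choose M hM0 hM using H.bounded_above
  choose! m hm0 hm using fun e (he : f e ≠ 0) => H.bounded_below he
  obtain ⟨K, hK⟩ := H.exists_energy_le hψ hφ
  have hsq : ∀ e t, 0 ≤ t → (σ t e * ψ t e) ^ 2 ≤ K / l e * σ t e := by
    intro e t ht
    have h1 := hK t ht e
    have h2 : σ t e * ψ t e ^ 2 ≤ K / l e := by
      rw [le_div_iff₀ (H.l_pos e)]; linarith
    calc (σ t e * ψ t e) ^ 2 = σ t e * ψ t e ^ 2 * σ t e := by ring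
      _ ≤ _ := mul_le_mul_of_nonneg_right h2 (H.pos t ht e).le
  have hoff : ∀ e, f e = 0 → ExpSmall fun t => σ t e * ψ t e := fun e he =>
    ExpSmall.of_sq (((H.expSmall_of_eq_zero he).const_mul (K / l e)).of_abs_le fun t ht => by
      rw [abs_of_nonneg (sq_nonneg _)]; exact hsq e t ht)
  have hdW : ∀ t, 0 ≤ t → (fun e => z e - σ t e * ψ t e) ∈ W := by
    intro t ht
    have := W.sub_mem hzW (hφ t ht)
    rwa [sub_sub_sub_cancel_right] at this
  have hbdd : ∀ e, ∃ B, ∀ t, 0 ≤ t → |z e - σ t e * ψ t e| ≤ B := by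
    intro e
    refine ⟨|z e| + (K / l e * M e + 1), fun t ht => (abs_sub _ _).trans ?_⟩
    gcongr
    have h1 := hsq e t ht
    have hK0 : 0 ≤ K := le_trans (by
      have := H.pos t ht e
      have := H.l_pos e
      positivity) (hK t ht e)
    have h2 : K / l e * σ t e ≤ K / l e * M e :=
      mul_le_mul_of_nonneg_left (hM e t ht) (div_nonneg hK0 (H.l_pos e).le)
    have h3 : |σ t e * ψ t e| ≤ (σ t e * ψ t e) ^ 2 + 1 := by
      rw [← sq_abs]; nlinarith [sq_nonneg (|σ t e * ψ t e| - 1)]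
    linarith
  choose B hB using hbdd
  have hcost : ExpSmall fun t => l ⬝ᵥ fun e => z e - σ t e * ψ t e := by
    obtain ⟨D, hD⟩ := H.exists_abs_cost_le
    have h1 : ExpSmall fun t => D * ∑ e with f e = 0, |z e - σ t e * ψ t e| := by
      refine (ExpSmall.sum _ fun e he => ?_).const_mul D
      have he' : f e = 0 := by simpa using he
      simpa [hz0 e he'] using (hoff e he').abs
    exact h1.of_abs_le fun t ht => hD _ (hdW t ht)
  have hpair : ∀ e, ExpSmall fun t =>
      l e * (z e - σ t e * ψ t e) * (z e / σ t e) - l e * (z e - σ t e * ψ t e) := by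
    intro e
    by_cases he : f e = 0
    · simpa [hz0 e he] using (hoff e he).const_mul (l e)
    · refine (hz e).of_le (K := l e * B e / m e) fun t ht => ?_
      have hσ := H.pos t ht e
      have h1 : l e * (z e - σ t e * ψ t e) * (z e / σ t e) - l e * (z e - σ t e * ψ t e) =
          -(l e * (z e - σ t e * ψ t e) / σ t e * (σ t e - z e)) := by
        field_simp; ring
      rw [h1, abs_neg, abs_mul, abs_div, abs_mul, abs_of_pos (H.l_pos e), abs_of_pos hσ]
      have h2 := hB e t ht
      have h3 := hm e he t ht
      have h4 := hm0 e he
      have h5 := H.l_pos e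
      have h6 : 0 ≤ B e := (abs_nonneg _).trans h2
      gcongr
  have hen : ExpSmall fun t => ∑ e, l e * ((z e - σ t e * ψ t e) ^ 2 / σ t e) := by
    refine ((ExpSmall.sum Finset.univ fun e _ => hpair e).add hcost).of_le (K := 1) fun t ht => ?_
    rw [one_mul]
    refine le_of_eq (congrArg _ ?_)
    rw [dotProduct, ← Finset.sum_add_distrib, ← add_zero (∑ e, _), ← hψ t ht _ (hdW t ht),
      ← Finset.sum_add_distrib]
    refine Finset.sum_congr rfl fun e _ => ?_
    have := (H.pos t ht e).ne'
    field_simp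
    ring
  refine ExpSmall.of_sq ((hen.const_mul (M e / l e)).of_abs_le fun t ht => ?_)
  have hl := H.l_pos e
  have hσ := H.pos t ht e
  have h1 := Finset.single_le_sum (f := fun e => l e * ((z e - σ t e * ψ t e) ^ 2 / σ t e))
    (fun e _ => by
      have := H.pos t ht e
      have := H.l_pos e
      positivity) (Finset.mem_univ e)
  have h2 : (z e - σ t e * ψ t e) ^ 2 / M e ≤ (z e - σ t e * ψ t e) ^ 2 / σ t e :=
    div_le_div_of_nonneg_left (sq_nonneg _) hσ (hM e t ht)
  have hMe := hM0 e
  calc |(σ t e * ψ t e - z e) ^ 2| = M e / l e * (l e * ((z e - σ t e * ψ t e) ^ 2 / M e)) := by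
        rw [abs_of_nonneg (sq_nonneg _)]; field_simp; ring
    _ ≤ M e / l e * (l e * ((z e - σ t e * ψ t e) ^ 2 / σ t e)) := by gcongr
    _ ≤ _ := mul_le_mul_of_nonneg_left h1 (div_pos hMe hl).le

end EntropicPath

/-! ### Optimal flows -/

section Graph

theorem cost_add_smul {V : Type*} [Fintype V] (G : Digraph V) [DecidableRel G.Adj]
    (l f h : Arc G → ℝ) (ε : ℝ) :
    cost G l (f + ε • h) = cost G l f + ε * l ⬝ᵥ h := by
  simp [cost, dotProduct_add, dotProduct_smul]

variable {V : Type*} [Fintype V] [DecidableEq V] {G : Digraph V} [DecidableRel G.Adj]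
  {b : V → ℝ} {l : Arc G → ℝ}

/-- Since all costs are positive, the positive flows of bounded cost form a compact set. -/
theorem optimalFlows_nonempty (l_pos : ∀ e, 0 < l e) (feasible : (positiveFlows G b).Nonempty) :
    (optimalFlows G b l).Nonempty := by
  obtain ⟨f₀, hf₀⟩ := feasible
  have hcost : Continuous (cost G l) := by unfold cost dotProduct; fun_prop
  have hflow : Continuous fun φ : Arc G → ℝ => boundary G *ᵥ φ :=
    Continuous.matrix_mulVec continuous_const continuous_id
  have hclosed : IsClosed (positiveFlows G b ∩ {φ | cost G l φ ≤ cost G l f₀}) := by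
    refine IsClosed.inter (IsClosed.inter (isClosed_eq hflow continuous_const) ?_)
      (isClosed_le hcost continuous_const)
    have : {φ : Arc G → ℝ | ∀ e, 0 ≤ φ e} = ⋂ e, {φ | 0 ≤ φ e} := by ext; simp
    change IsClosed {φ : Arc G → ℝ | ∀ e, 0 ≤ φ e}
    rw [this]
    exact isClosed_iInter fun e => isClosed_le continuous_const (continuous_apply e)
  have hcompact : IsCompact (positiveFlows G b ∩ {φ | cost G l φ ≤ cost G l f₀}) := by
    refine (isCompact_univ_pi fun e : Arc G => isCompact_Icc (a := (0 : ℝ))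
      (b := cost G l f₀ / l e)).of_isClosed_subset hclosed ?_
    rintro φ ⟨⟨_, h0⟩, hle⟩ e _
    refine ⟨h0 e, ?_⟩
    rw [le_div_iff₀ (l_pos e), mul_comm]
    exact (Finset.single_le_sum (f := fun e => l e * φ e)
      (fun e _ => mul_nonneg (l_pos e).le (h0 e)) (Finset.mem_univ e)).trans hle
  obtain ⟨f, ⟨hf, hff₀⟩, hmin⟩ := hcompact.exists_isMinOn ⟨f₀, hf₀, le_refl (cost G l f₀)⟩
    hcost.continuousOn
  refine ⟨f, hf, fun g hg => ?_⟩
  rcases le_total (cost G l g) (cost G l f₀) with h | h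
  · exact hmin ⟨hg, h⟩
  · exact hff₀.trans h

/-- Averaging optimal flows gives an optimal flow that uses every arc of the optimal subgraph. -/
theorem exists_optimalFlow_support_eq (l_pos : ∀ e, 0 < l e)
    (feasible : (positiveFlows G b).Nonempty) :
    ∃ f ∈ optimalFlows G b l, Function.support f = optimalArcs G b l := by
  classical
  have key : ∀ s : Finset (Arc G), ∃ f ∈ optimalFlows G b l,
      ∀ e ∈ s, e ∈ optimalArcs G b l → f e ≠ 0 := by
    intro s
    induction s using Finset.induction_on with
    | empty =>
      obtain ⟨f, hf⟩ := optimalFlows_nonempty l_pos feasible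
      exact ⟨f, hf, by simp⟩
    | insert a s _ ih =>
      obtain ⟨f, hf, hfs⟩ := ih
      by_cases ha : a ∈ optimalArcs G b l
      swap
      · refine ⟨f, hf, fun e he heo => ?_⟩
        rcases Finset.mem_insert.1 he with rfl | he
        · exact absurd heo ha
        · exact hfs e he heo
      obtain ⟨g, hg, hga⟩ : ∃ g ∈ optimalFlows G b l, g a ≠ 0 := by
        simpa [optimalArcs] using ha
      have h1 := hf.1.2
      have h2 := hg.1.2
      refine ⟨f + (1 / 2 : ℝ) • (g - f), ⟨⟨?_, fun e => ?_⟩, fun k hk => ?_⟩, fun e he heo => ?_⟩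
      · rw [Matrix.mulVec_add, Matrix.mulVec_smul, Matrix.mulVec_sub, hf.1.1, hg.1.1]
        simp
      · simp only [Pi.add_apply, Pi.smul_apply, Pi.sub_apply, smul_eq_mul]
        linarith [h1 e, h2 e]
      · have h3 := hf.2 k hk
        have h4 := hg.2 k hk
        rw [cost_add_smul, dotProduct_sub]
        unfold cost at *
        linarith
      · simp only [Pi.add_apply, Pi.smul_apply, Pi.sub_apply, smul_eq_mul]
        have h3 : 0 < f e ∨ 0 < g e := by
          rcases Finset.mem_insert.1 he with rfl | he
          · exact Or.inr ((h2 _).lt_of_ne' hga)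
          · exact Or.inl ((h1 e).lt_of_ne' (hfs e he heo))
        rcases h3 with h3 | h3
        · linarith [h2 e]
        · linarith [h1 e]
  obtain ⟨f, hf, hfs⟩ := key Finset.univ
  refine ⟨f, hf, Set.Subset.antisymm (fun e he => ?_) fun e he => hfs e (Finset.mem_univ e) he⟩
  exact Set.mem_biUnion hf he

/-- The circulations: the kernel of the boundary operator. -/
def circulations (G : Digraph V) [DecidableRel G.Adj] : Submodule ℝ (Arc G → ℝ) :=
  LinearMap.ker (boundary G).mulVecLin

theorem mem_circulations {h : Arc G → ℝ} : h ∈ circulations G ↔ boundary G *ᵥ h = 0 := by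
  simp [circulations]

/-- A direction that does not decrease the zero entries of `f ≥ 0` is feasible for a short step. -/
theorem exists_add_smul_nonneg {E : Type*} [Fintype E] {f h : E → ℝ} (hf : ∀ e, 0 ≤ f e)
    (hh : ∀ e, f e = 0 → 0 ≤ h e) : ∃ ε : ℝ, 0 < ε ∧ ∀ e, 0 ≤ f e + ε * h e := by
  have h1 : ∀ e, ∀ᶠ ε in nhdsWithin (0 : ℝ) (Set.Ioi 0), 0 ≤ f e + ε * h e := by
    intro e
    by_cases he : f e = 0
    · filter_upwards [self_mem_nhdsWithin] with ε hε
      rw [he, zero_add]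
      exact mul_nonneg (le_of_lt hε) (hh e he)
    · have hc : Filter.Tendsto (fun ε : ℝ => f e + ε * h e) (nhds 0) (nhds (f e + 0 * h e)) :=
        (by fun_prop : Continuous fun ε : ℝ => f e + ε * h e).tendsto 0
      rw [zero_mul, add_zero] at hc
      filter_upwards [nhdsWithin_le_nhds (hc.eventually (lt_mem_nhds ((hf e).lt_of_ne' he)))]
        with ε hε using le_of_lt hε
  obtain ⟨ε, hε, hε0⟩ := ((Filter.eventually_all.2 h1).and self_mem_nhdsWithin).exists
  exact ⟨ε, hε0, hε⟩

/-- A circulation that may be added to an optimal flow `f` of full support has nonnegative cost; if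
the cost is zero, the sum is again optimal, so the circulation lives on `supp f`. -/
theorem optimalFlow_opt {f : Arc G → ℝ} (hf : f ∈ optimalFlows G b l)
    (hsupp : Function.support f = optimalArcs G b l) {h : Arc G → ℝ} (hh : h ∈ circulations G)
    (hpos : ∀ e, f e = 0 → 0 ≤ h e) :
    0 ≤ l ⬝ᵥ h ∧ (l ⬝ᵥ h = 0 → ∀ e, f e = 0 → h e = 0) := by
  obtain ⟨ε, hε, hε'⟩ := exists_add_smul_nonneg hf.1.2 hpos
  have hmem : f + ε • h ∈ positiveFlows G b := by
    refine ⟨?_, fun e => by simpa using hε' e⟩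
    rw [Matrix.mulVec_add, Matrix.mulVec_smul, mem_circulations.1 hh, hf.1.1]
    simp
  have hle := hf.2 _ hmem
  rw [cost_add_smul] at hle
  refine ⟨?_, fun h0 e he => ?_⟩
  · by_contra hneg
    push Not at hneg
    linarith [mul_neg_of_pos_of_neg hε hneg]
  · have hopt : f + ε • h ∈ optimalFlows G b l :=
      ⟨hmem, fun k hk => by rw [cost_add_smul, h0, mul_zero, add_zero]; exact hf.2 k hk⟩
    by_contra hne
    have : e ∈ optimalArcs G b l := Set.mem_biUnion hopt (by simp [he, hε.ne', hne])
    rw [← hsupp] at this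
    exact this he

/-! ### The Physarum solver -/

theorem eq_zero_of_hasDerivWithinAt_zero {F : ℝ → ℝ}
    (hF : ∀ t, 0 ≤ t → HasDerivWithinAt F 0 (Set.Ici 0) t) {t : ℝ} (ht : 0 ≤ t) : F t = F 0 := by
  refine constant_of_has_deriv_right_zero (f := F) (a := 0) (b := t) (fun s hs => ?_)
    (fun s hs => (hF s hs.1).mono (Set.Ici_subset_Ici.2 hs.1)) t ⟨ht, le_rfl⟩
  exact (hF s hs.1).continuousWithinAt.mono Set.Icc_subset_Ici_self

variable {σ φ : ℝ → Arc G → ℝ}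

theorem IsCurrent.boundary_mulVec {b : V → ℝ} {l s c : Arc G → ℝ} {p : V → ℝ}
    (hp : laplacian G l s *ᵥ p = b) (hc : ∀ e, c e = s e * field G l p e) :
    boundary G *ᵥ c = b := by
  rw [← hp, laplacian, ← Matrix.mulVec_mulVec, ← Matrix.mulVec_mulVec]
  congr 1
  ext e
  rw [hc, Matrix.mulVec_diagonal, field]
  ring

/-- The field of a potential is orthogonal to all circulations. -/
theorem sum_mul_field_eq_zero (l_pos : ∀ e, 0 < l e) (p : V → ℝ) {h : Arc G → ℝ}
    (hh : h ∈ circulations G) : ∑ e, l e * h e * field G l p e = 0 := by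
  have h1 : ∑ e, l e * h e * field G l p e = h ⬝ᵥ ((boundary G)ᵀ *ᵥ p) := by
    refine Finset.sum_congr rfl fun e _ => ?_
    have := (l_pos e).ne'
    rw [field]
    field_simp
  rw [h1, Matrix.dotProduct_mulVec, Matrix.vecMul_transpose, mem_circulations.1 hh,
    zero_dotProduct]

/-- The conductivities of a Physarum solver form an entropic path: the imbalance `B σ - b` decays
like `e⁻ᵗ`, and for a circulation `h` the quantity `∑ l h log σ` has the constant derivative
`-lᵀ h`, since `σ' / σ` is the field minus one. -/
theorem IsPhysarumSolver.entropicPath (solver : IsPhysarumSolver G b l σ φ)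
    (l_pos : ∀ e, 0 < l e) {f : Arc G → ℝ} (hf : f ∈ optimalFlows G b l)
    (hsupp : Function.support f = optimalArcs G b l) :
    EntropicPath (circulations G) l f σ where
  l_pos := l_pos
  f_nonneg := hf.1.2
  opt _ hh hpos := optimalFlow_opt hf hsupp hh hpos
  pos := solver.pos
  mem t ht := by
    rw [mem_circulations, Matrix.mulVec_sub, sub_eq_zero]
    ext i
    -- `eˢ (B σ - b)` is conserved because `B φ = b`.
    have hF : ∀ s, 0 ≤ s → HasDerivWithinAt
        (fun s => Real.exp s * ((boundary G *ᵥ σ s) i - b i)) 0 (Set.Ici 0) s := by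
      intro s hs
      obtain ⟨p, hp, hc⟩ := solver.current s hs
      have h1 : HasDerivWithinAt (fun s => (boundary G *ᵥ σ s) i)
          (∑ e, boundary G i e * (φ s e - σ s e)) (Set.Ici 0) s :=
        HasDerivWithinAt.fun_sum fun e _ => (solver.evolution s hs e).const_mul _
      have h2 := (Real.hasDerivAt_exp s).hasDerivWithinAt.mul (h1.sub_const (b i))
      have h3 : ∑ e, boundary G i e * (φ s e - σ s e) = b i - (boundary G *ᵥ σ s) i := by
        rw [← congrFun (IsCurrent.boundary_mulVec hp hc) i]
        simp [Matrix.mulVec, dotProduct, mul_sub, Finset.sum_sub_distrib]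
      refine h2.congr_deriv ?_
      rw [h3]
      ring
    have h1 := eq_zero_of_hasDerivWithinAt_zero hF ht
    have h2 : (boundary G *ᵥ comparison f (σ 0) t) i =
        (1 - Real.exp (-t)) * b i + Real.exp (-t) * (boundary G *ᵥ σ 0) i := by
      have : comparison f (σ 0) t = (1 - Real.exp (-t)) • f + Real.exp (-t) • σ 0 := rfl
      rw [this, Matrix.mulVec_add, Matrix.mulVec_smul, Matrix.mulVec_smul, hf.1.1]
      rfl
    have h3 : Real.exp (-t) * Real.exp t = 1 := by rw [← Real.exp_add]; simp
    have h4 := congrArg (Real.exp (-t) * ·) h1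
    simp only [Real.exp_zero, one_mul, ← mul_assoc, h3] at h4
    rw [h2]
    linarith
  log t ht h hh := by
    have hF : ∀ s, 0 ≤ s → HasDerivWithinAt
        (fun s => ∑ e, l e * h e * Real.log (σ s e) + s * l ⬝ᵥ h) 0 (Set.Ici 0) s := by
      intro s hs
      obtain ⟨p, -, hc⟩ := solver.current s hs
      have h1 : HasDerivWithinAt (fun s => ∑ e, l e * h e * Real.log (σ s e))
          (∑ e, l e * h e * ((φ s e - σ s e) / σ s e)) (Set.Ici 0) s :=
        HasDerivWithinAt.fun_sum fun e _ =>
          ((solver.evolution s hs e).log (solver.pos s hs e).ne').const_mul _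
      have h2 := h1.add ((hasDerivWithinAt_id s (Set.Ici 0)).mul_const (l ⬝ᵥ h))
      refine h2.congr_deriv ?_
      have h3 := sum_mul_field_eq_zero l_pos p hh
      rw [one_mul, dotProduct, ← Finset.sum_add_distrib, ← h3]
      refine Finset.sum_congr rfl fun e _ => ?_
      have := (solver.pos s hs e).ne'
      rw [hc e]
      field_simp
      ring
    have h1 := eq_zero_of_hasDerivWithinAt_zero hF ht
    have h2 : ∑ e, l e * h e * Real.log (σ t e / σ 0 e) =
        ∑ e, l e * h e * Real.log (σ t e) - ∑ e, l e * h e * Real.log (σ 0 e) := by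
      rw [← Finset.sum_sub_distrib]
      refine Finset.sum_congr rfl fun e _ => ?_
      rw [Real.log_div (solver.pos t ht e).ne' (solver.pos 0 le_rfl e).ne', mul_sub]
    rw [h2]
    linarith

end Graph

end Physarum

theorem theorem1 {V : Type*} [Fintype V] [DecidableEq V] (G : Digraph V) [DecidableRel G.Adj]
    (loopless : ∀ v, ¬ G.Adj v v) (connected : G.toSimpleGraphInclusive.Connected)
    (b : V → ℝ) (l : Physarum.Arc G → ℝ) (l_pos : ∀ e, 0 < l e)
    (feasible : (Physarum.positiveFlows G b).Nonempty)
    (σ φ : ℝ → Physarum.Arc G → ℝ) (solver : Physarum.IsPhysarumSolver G b l σ φ) :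
    ∃ φlim ∈ Physarum.optimalFlows G b l,
      (∃ C c : ℝ, 0 < c ∧ ∀ t, 0 ≤ t → ∀ e, |φ t e - φlim e| ≤ C * Real.exp (-(c * t))) ∧
      Function.support φlim = Physarum.optimalArcs G b l := by
  open Physarum in
  obtain ⟨f, hf, hsupp⟩ := exists_optimalFlow_support_eq l_pos feasible
  have H := solver.entropicPath l_pos hf hsupp
  obtain ⟨z, hzW, hz0, hzpos, hz⟩ := H.exists_limit
  choose! p hp hφ using solver.current
  have hlim : ∀ e, ExpSmall fun t => φ t e - z e := by
    intro e
    have h1 := H.expSmall_current_sub (ψ := fun t => field G l (p t))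
      (fun t _ h hh => sum_mul_field_eq_zero l_pos (p t) hh) (fun t ht => ?_) hzW hz0 hz e
    · refine h1.of_le (K := 1) fun t ht => ?_
      rw [hφ t ht e, one_mul]
    · rw [mem_circulations, Matrix.mulVec_sub, hf.1.1,
        IsCurrent.boundary_mulVec (hp t ht) fun _ => rfl, sub_self]
  have hznonneg : ∀ e, 0 ≤ z e := fun e => by
    by_cases he : f e = 0
    · exact (hz0 e he).ge
    · exact (hzpos e he).le
  refine ⟨z, ⟨⟨?_, hznonneg⟩, fun k hk => ?_⟩, ?_, ?_⟩
  · rw [mem_circulations, Matrix.mulVec_sub, sub_eq_zero] at hzW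
    rw [hzW, hf.1.1]
  · have h1 := H.cost_eq_zero hzW fun e he => by simp [he, hz0 e he]
    rw [dotProduct_sub, sub_eq_zero] at h1
    exact h1.trans_le (hf.2 k hk)
  · -- A common bound for all arcs: the sum of the deviations is exponentially small.
    obtain ⟨C, c, hc, hC⟩ := ExpSmall.sum Finset.univ fun e _ => (hlim e).abs
    refine ⟨C, c, hc, fun t ht e => le_trans ?_ ((le_abs_self _).trans (hC t ht))⟩
    exact Finset.single_le_sum (f := fun e => |φ t e - z e|) (fun e _ => abs_nonneg _)
      (Finset.mem_univ e)
  · rw [← hsupp]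
    ext e
    simp only [Function.mem_support]
    exact ⟨fun h h' => h (hz0 e h'), fun h => (hzpos e h).ne'⟩
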